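/- Let $\mathcal A$ be a unital $C^*$-algebra, $U$ a (left) Hilbert $\mathcal A$-module with $\mathcal A$-valued inner product $\langle\cdot,\cdot\rangle$, $\mathcal A$-linear in the first variable, and $(\Omega,\mu)$ a measure space. Integrals of $\mathcal A$-valued functions are weak (Pettis) integrals: $a=\int h\,d\mu$ means that for every $\ell\in\mathcal A^*$ the function $\ell\circ h$ is integrable and $\int \ell(h)\,d\mu=\ell(a)$; this agrees with the Bochner integral whenever the latter exists. For $\varphi:\Omega\to\mathcal A$ and $F:\Omega\to U$, $u=\int\varphi F\,d\mu\in U$ means $\langle u,f\rangle=\int\varphi(\omega)\langle F(\omega),f\rangle\,d\mu(\omega)$ for all $f\in U$. Measurability of $\mathcal A$-valued functions means a.e. strong measurability. Let $L^2(\Omega,\mathcal A)$ be the set of measurable $\varphi:\Omega\to\mathcal A$ for which $\int|\varphi^*|^2\,d\mu=\int\varphi\varphi^*\,d\mu$ exists in $\mathcal A$. A map $F:\Omega\to U$ is called Bessel if $\omega\mapsto\langle f,F(\omega)\rangle$ is measurable for every $f\in U$ and there is $\beta>0$ such that for all $f\in U$ the integral $\int\langle f,F(\omega)\rangle\langle F(\omega),f\rangle\,d\mu(\omega)$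 exists and is $\le\beta\langle f,f\rangle$. It is called a continuous Riesz basis of $U$ if it is Bessel, if $f=0$ is the only $f\in U$ with $\langle f,F(\omega)\rangle=0$ for a.e. $\omega$, and if there are constants $A,B>0$ such that for all $\varphi\in L^2(\Omega,\mathcal A)$ and all measurable $\Omega_1\subseteq\Omega$ with $\mu(\Omega_1)<\infty$ the following integrals exist and satisfy $$A\Big\|\int_{\Omega_1}|\varphi^*|^2\,d\mu\Big\|^{1/2}\le\Big\|\int_{\Omega_1}\varphi F\,d\mu\Big\|\le B\Big\|\int_{\Omega_1}|\varphi^*|^2\,d\mu\Big\|^{1/2}.$$ Let $F,G:\Omega\to U$ be two continuous Riesz bases of $U$. Then the pre-frame operators $T_F\varphi=\int\varphi F\,d\mu$ and $T_G\varphi=\int\varphi G\,d\mu$ are defined for all $\varphi\in L^2(\Omega,\mathcal A)$, the functions $T_F^*f=\langle f,F(\cdot)\rangle$ and $T_G^*f=\langle f,G(\cdot)\rangle$ belong to $L^2(\Omega,\mathcal A)$ for all $f\in U$, and the frame operator $S_G f=\int\langle f,G(\omega)\rangle G(\omega)\,d\mu(\omega)$ of $G$ is defined on $U$, with $\langle S_Gf,f\rangle=\int\langle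 f,G(\omega)\rangle\langle G(\omega),f\rangle\,d\mu(\omega)$ for all $f\in U$. The operator $T_GT_F^*:U\to U$ is adjointable and bijective, its inverse $K=(T_GT_F^*)^{-1}$ is adjointable, and $G=S_GK^*F$ in the following sense: for every $f\in U$, $$\langle f,G(\omega)\rangle=\langle f,S_GK^*F(\omega)\rangle\quad\text{for a.e. }\omega\in\Omega,$$ and if $F$ and $G$ take their values, for a.e. $\omega$, in a separable subset of $U$ (in particular if $U$ is separable, or if $F$ and $G$ are strongly measurable), then $G(\omega)=S_GK^*F(\omega)$ for a.e. $\omega\in\Omega$. -/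

import Mathlib

open MeasureTheory

namespace HilbertModuleFrames

/-- The `A`-valued inner product `⟨f, g⟩`, `A`-linear in the FIRST variable
(`⟨a • f, g⟩ = a * ⟨f, g⟩`). Mathlib's `inner A` is `A`-linear in the second variable,
so the two arguments are swapped. -/
abbrev ip (A : Type*) {U : Type*} [Inner A U] (f g : U) : A := inner A g f

section Integrals

variable {Ω A : Type*} [MeasurableSpace Ω] [CStarAlgebra A]

/-- `a = ∫ h dμ` as a weak integral in the Banach space `A`: every continuous linear functional
`l` has `l ∘ h` integrable with `∫ l (h ω) dμ(ω) = l a`. Such an `a` is unique, and it is the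
Bochner integral whenever `h` is Bochner integrable. For the counting measure and `h ≥ 0` it is
the sum of the norm convergent series `∑ h ω`. -/
def HasIntegral (μ : Measure Ω) (h : Ω → A) (a : A) : Prop :=
  ∀ l : A →L[ℂ] ℂ, Integrable (fun ω => l (h ω)) μ ∧ ∫ ω, l (h ω) ∂μ = l a

/-- `L²(Ω, A)`: the strongly measurable `φ : Ω → A` for which `∫ |φ(ω)^*|² dμ(ω)` exists in `A`,
where `|φ^*|² = φ φ^*`. Its elements are functions, equality of which is understood a.e. -/
def L2 (A : Type*) [CStarAlgebra A] (μ : Measure Ω) : Set (Ω → A) :=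
  {φ | AEStronglyMeasurable φ μ ∧ ∃ a : A, HasIntegral μ (fun ω => φ ω * star (φ ω)) a}

end Integrals

section Frames

variable {Ω A U : Type*} [MeasurableSpace Ω]
  [CStarAlgebra A] [PartialOrder A] [StarOrderedRing A]
  [NormedAddCommGroup U] [NormedSpace ℂ U] [Module A U] [CStarModule A U]

/-- `u = ∫ φ(ω) F(ω) dμ(ω)`, weakly: `⟨u, f⟩ = ∫ φ(ω) ⟨F(ω), f⟩ dμ(ω)` for all `f`. -/
def HasVectorIntegral (μ : Measure Ω) (φ : Ω → A) (F : Ω → U) (u : U) : Prop :=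
  ∀ f : U, HasIntegral μ (fun ω => φ ω * ip A (F ω) f) (ip A u f)

variable (A) in
/-- `F` is weakly measurable: every `ω ↦ ⟨f, F(ω)⟩` is (strongly, a.e.) measurable. -/
def WeaklyMeasurable (μ : Measure Ω) (F : Ω → U) : Prop :=
  ∀ f : U, AEStronglyMeasurable (fun ω => ip A f (F ω)) μ

variable (A) in
/-- `F` is a Bessel mapping: it is weakly measurable, and for some `β > 0`,
`∫ ⟨f, F(ω)⟩ ⟨F(ω), f⟩ dμ(ω)` exists and is `≤ β ⟨f, f⟩` for all `f`. -/
def IsBessel (μ : Measure Ω) (F : Ω → U) : Prop :=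
  WeaklyMeasurable A μ F ∧ ∃ β : ℝ, 0 < β ∧ ∀ f : U, ∃ a : A,
    HasIntegral μ (fun ω => ip A f (F ω) * ip A (F ω) f) a ∧ a ≤ β • ip A f f

variable (A) in
/-- `F` is a `μ`-complete Bessel mapping. -/
def IsMuComplete (μ : Measure Ω) (F : Ω → U) : Prop :=
  IsBessel A μ F ∧ ∀ f : U, (∀ᵐ ω ∂μ, ip A f (F ω) = 0) → f = 0

variable (A) in
/-- `F` is a continuous Riesz basis. The integrals in the two-sided estimate are required to
exist. -/
def IsContinuousRieszBasis (μ : Measure Ω) (F : Ω → U) : Prop :=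
  WeaklyMeasurable A μ F ∧ IsMuComplete A μ F ∧
  ∃ α β : ℝ, 0 < α ∧ 0 < β ∧
    ∀ φ ∈ L2 A μ, ∀ Ω₁ : Set Ω, MeasurableSet Ω₁ → μ Ω₁ < ⊤ →
      ∃ (a : A) (u : U),
        HasIntegral (μ.restrict Ω₁) (fun ω => φ ω * star (φ ω)) a ∧
        HasVectorIntegral (μ.restrict Ω₁) φ F u ∧
        α * √‖a‖ ≤ ‖u‖ ∧ ‖u‖ ≤ β * √‖a‖

open Classical in
/-- The synthesis (pre-frame) operator `T_F φ = ∫ φ(ω) F(ω) dμ(ω)`, with the value `0` where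
this weak integral does not exist. -/
noncomputable def synthesis (μ : Measure Ω) (F : Ω → U) (φ : Ω → A) : U :=
  if h : ∃ u : U, HasVectorIntegral μ φ F u then h.choose else 0

variable (A) in
/-- The analysis operator `(T_F^* f)(ω) = ⟨f, F(ω)⟩`. -/
def analysis (F : Ω → U) (f : U) : Ω → A := fun ω => ip A f (F ω)

variable (A) in
/-- The frame operator: `S_F f = ∫ ⟨f, F(ω)⟩ F(ω) dμ(ω)`, weakly, that is,
`⟨S_F f, g⟩ = ∫ ⟨f, F(ω)⟩ ⟨F(ω), g⟩ dμ(ω)` for all `g`. -/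
noncomputable def frameOperator (μ : Measure Ω) (F : Ω → U) (f : U) : U :=
  synthesis μ F (fun ω => ip A f (F ω))

variable (A) in
/-- `T'` is the adjoint of the map `T`. -/
def IsAdjoint (T T' : U → U) : Prop :=
  ∀ f g : U, ip A (T f) g = ip A f (T' g)

end Frames

end HilbertModuleFrames

/-! Write `T_F` for synthesis, `T_F^*` for analysis and `S_F = T_F T_F^*`. The Riesz bounds, assumed
on sets of finite measure, pass to all of `Ω` (`exists_vectorIntegral`), so `T_F` is defined and
injective on `L²` up to null sets.

The main point is that `S_F` is onto (`frame_surjective`). The lower Riesz bound and Cauchy–Schwarz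
bound `⟨S_F v, v⟩` below in norm for `v` in the range of `S_F`, and a positive injective operator
with such a bound is surjective. Injectivity of `T_F` then makes every `L²` function equal a.e. to
some `T_F^* f`.

So `T_G T_F^*` is bijective, with adjoint `T_F T_G^*`. Moreover `T_G T_F^* (K S_G f) = S_G f = T_G
T_G^* f`, and injectivity of `T_G` gives `⟨K S_G f, F⟩ = ⟨f, G⟩` a.e.; moving `K` and `S_G` to the
other side is the formula. The null set depends on `f`; separability of the values makes it uniform.
-/

namespace HilbertModuleFrames

open Filter Topology

/-! ### Weak integrals in a C*-algebra -/

section Integrals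

variable {Ω A : Type*} [MeasurableSpace Ω] [CStarAlgebra A] {μ : Measure Ω}

namespace HasIntegral

theorem unique {h : Ω → A} {a b : A} (ha : HasIntegral μ h a) (hb : HasIntegral μ h b) :
    a = b :=
  (SeparatingDual.eq_iff_forall_dual_eq (R := ℂ)).2 fun l => (ha l).2.symm.trans (hb l).2

theorem congr_ae {h k : Ω → A} {a : A} (ha : HasIntegral μ h a) (hk : h =ᵐ[μ] k) :
    HasIntegral μ k a := fun l => by
  have e : (fun ω => l (h ω)) =ᵐ[μ] fun ω => l (k ω) := hk.fun_comp l
  exact ⟨(ha l).1.congr e, (integral_congr_ae e).symm.trans (ha l).2⟩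

theorem map {h : Ω → A} {a : A} (ha : HasIntegral μ h a) (T : A →L[ℂ] A) :
    HasIntegral μ (fun ω => T (h ω)) (T a) := fun l => ha (l.comp T)

theorem add {h k : Ω → A} {a b : A} (ha : HasIntegral μ h a) (hb : HasIntegral μ k b) :
    HasIntegral μ (fun ω => h ω + k ω) (a + b) := fun l => by
  simp only [map_add]
  exact ⟨(ha l).1.add (hb l).1, by rw [integral_add (ha l).1 (hb l).1, (ha l).2, (hb l).2]⟩

theorem sub {h k : Ω → A} {a b : A} (ha : HasIntegral μ h a) (hb : HasIntegral μ k b) :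
    HasIntegral μ (fun ω => h ω - k ω) (a - b) := fun l => by
  simp only [map_sub]
  exact ⟨(ha l).1.sub (hb l).1, by rw [integral_sub (ha l).1 (hb l).1, (ha l).2, (hb l).2]⟩

theorem const_mul {h : Ω → A} {a : A} (ha : HasIntegral μ h a) (x : A) :
    HasIntegral μ (fun ω => x * h ω) (x * a) := ha.map (ContinuousLinearMap.mul ℂ A x)

theorem mul_const {h : Ω → A} {a : A} (ha : HasIntegral μ h a) (x : A) :
    HasIntegral μ (fun ω => h ω * x) (a * x) :=
  ha.map ((ContinuousLinearMap.mul ℂ A).flip x)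

theorem star {h : Ω → A} {a : A} (ha : HasIntegral μ h a) :
    HasIntegral μ (fun ω => star (h ω)) (star a) := fun l => by
  -- Conjugating before and after `l` restores complex linearity.
  let l' : A →L[ℂ] ℂ := ((starL ℂ : ℂ ≃L⋆[ℂ] ℂ) : ℂ →L⋆[ℂ] ℂ).comp
    (l.comp ((starL ℂ : A ≃L⋆[ℂ] A) : A →L⋆[ℂ] A))
  have key : ∀ x, l (Star.star x) = (starRingEnd ℂ) (l' x) := fun x => by simp [l']
  simp only [key]
  refine ⟨?_, ?_⟩
  · exact ((starL' ℝ : ℂ ≃L[ℝ] ℂ) : ℂ →L[ℝ] ℂ).integrable_comp (ha l').1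
  · rw [integral_conj, (ha l').2]

theorem zero : HasIntegral μ (fun _ => (0 : A)) 0 := fun l => by simp

theorem union {h : Ω → A} {a b : A} {s t : Set Ω} (ha : HasIntegral (μ.restrict s) h a)
    (hb : HasIntegral (μ.restrict t) h b) (hst : Disjoint s t) (ht : MeasurableSet t) :
    HasIntegral (μ.restrict (s ∪ t)) h (a + b) := fun l => by
  have h1 : IntegrableOn (fun ω => l (h ω)) s μ := (ha l).1
  have h2 : IntegrableOn (fun ω => l (h ω)) t μ := (hb l).1
  refine ⟨h1.union h2, ?_⟩
  rw [setIntegral_union hst ht h1 h2, (ha l).2, (hb l).2, map_add]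

theorem of_compl {h : Ω → A} {a b : A} {s : Set Ω} (hs : MeasurableSet s)
    (ha : HasIntegral μ h a) (hb : HasIntegral (μ.restrict s) h b) :
    HasIntegral (μ.restrict sᶜ) h (a - b) := fun l => by
  refine ⟨(ha l).1.restrict, ?_⟩
  have := integral_add_compl hs (ha l).1
  rw [(hb l).2, (ha l).2] at this
  rw [map_sub, ← this]; abel

end HasIntegral

/-- A strongly measurable weakly integrable function vanishes off a `σ`-finite set. -/
theorem HasIntegral.exists_sigmaFinite_support {h : Ω → A} {a : A} (ha : HasIntegral μ h a)
    (hm : AEStronglyMeasurable h μ) : ∃ D : ℕ → Set Ω, (∀ n, MeasurableSet (D n)) ∧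
      (∀ n, μ (D n) < ⊤) ∧ ∀ᵐ ω ∂μ, ω ∉ ⋃ n, D n → h ω = 0 := by
  obtain ⟨k, hk, hhk⟩ := hm
  have hk' := ha.congr_ae hhk
  obtain ⟨c, hc, hck⟩ := hk.isSeparable_range
  choose l hl1 hl2 using fun x : A => exists_dual_vector'' ℂ x
  have : Countable c := hc.to_subtype
  -- Each set has finite measure because `l x ∘ k` is integrable. They cover `{k ≠ 0}`: if `x` is
  -- within `‖k ω‖ / 2` of `k ω`, the functional norming `x` cannot vanish at `k ω`.
  let D : c × ℕ → Set Ω := fun i => {ω | 1 / ((i.2 : ℝ) + 1) ≤ ‖l i.1 (k ω)‖}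
  have hDm : ∀ i, MeasurableSet (D i) := fun i =>
    measurableSet_le measurable_const
      ((l i.1).continuous.comp_stronglyMeasurable hk).norm.measurable
  have hDf : ∀ i, μ (D i) < ⊤ := fun i =>
    (hk' (l i.1)).1.measure_norm_ge_lt_top (by positivity)
  have hD : ∀ ω, k ω ≠ 0 → ω ∈ ⋃ i, D i := by
    intro ω hω
    obtain ⟨x, hx, hxk⟩ := Metric.mem_closure_iff.1 (hck ⟨ω, rfl⟩) (‖k ω‖ / 2)
      (half_pos (norm_pos_iff.2 hω))
    rw [dist_eq_norm] at hxk
    have h1 : ‖l x x‖ = ‖x‖ := by rw [hl2]; simp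
    have h2 : ‖l x (k ω - x)‖ ≤ ‖k ω - x‖ := by
      simpa using (l x).le_of_opNorm_le (hl1 x) (k ω - x)
    have h3 : ‖k ω‖ ≤ ‖k ω - x‖ + ‖x‖ := by simpa using norm_add_le (k ω - x) x
    have h4 : ‖l x x‖ ≤ ‖l x (k ω - x)‖ + ‖l x (k ω)‖ := by
      have := norm_sub_le (l x (k ω)) (l x (k ω - x))
      rw [← map_sub, sub_sub_cancel] at this
      linarith
    have h5 : 0 < ‖l x (k ω)‖ := by linarith
    obtain ⟨n, hn⟩ := exists_nat_one_div_lt h5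
    exact Set.mem_iUnion.2 ⟨(⟨x, hx⟩, n), hn.le⟩
  rcases isEmpty_or_nonempty c with hemp | hne
  · refine ⟨fun _ => ∅, by simp, by simp, hhk.mono fun ω hω _ => ?_⟩
    rw [hω]
    by_contra hne
    obtain ⟨i, -⟩ := Set.mem_iUnion.1 (hD ω hne)
    exact hemp.false i.1
  · obtain ⟨e, he⟩ := exists_surjective_nat (c × ℕ)
    refine ⟨fun n => D (e n), fun n => hDm _, fun n => hDf _, hhk.mono fun ω hω hn => ?_⟩
    rw [hω]
    by_contra hne
    rw [he.iUnion_comp D] at hn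
    exact hn (hD ω hne)

/-- A strongly measurable function whose weak integrals over all sets of finite measure vanish
is zero almost everywhere. -/
theorem HasIntegral.ae_eq_zero {h : Ω → A} {a : A} (ha : HasIntegral μ h a)
    (hm : AEStronglyMeasurable h μ)
    (h0 : ∀ s, MeasurableSet s → μ s < ⊤ → HasIntegral (μ.restrict s) h 0) : h =ᵐ[μ] 0 := by
  obtain ⟨t, ht, hmem⟩ := hm.isSeparable_ae_range
  refine ae_eq_zero_of_forall_dual_of_isSeparable ℂ ht (fun l => ?_) hmem
  refine (ha l).1.ae_eq_zero_of_forall_setIntegral_eq_zero fun s hs hμ => ?_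
  rw [(h0 s hs hμ l).2, map_zero]

variable [PartialOrder A] [StarOrderedRing A]

/-- The positive cone is closed and convex, so a non-positive `a` would be separated from it by a
functional; bounded below on a cone, its real part is nonnegative there, and integrating contradicts
the separation. -/
theorem HasIntegral.nonneg {h : Ω → A} {a : A} (ha : HasIntegral μ h a)
    (hh : ∀ᵐ ω ∂μ, 0 ≤ h ω) : 0 ≤ a := by
  by_contra hn
  obtain ⟨l, u, hu, hl⟩ := RCLike.geometric_hahn_banach_point_closed (𝕜 := ℂ)
    (t := Set.Ici (0 : A)) (convex_Ici 0) CStarAlgebra.isClosed_nonneg hn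
  have hu0 : u < 0 := by simpa using hl 0 le_rfl
  have hpos : ∀ x : A, 0 ≤ x → 0 ≤ (l x).re := fun x hx => by
    by_contra! hneg
    -- This multiple of `x` lies in the cone and is sent exactly to the separating value `u`.
    have := hl ((u / (l x).re) • x) (smul_nonneg (div_pos_of_neg_of_neg hu0 hneg).le hx)
    rw [← Complex.coe_smul, map_smul] at this
    simp [div_mul_cancel₀ _ hneg.ne] at this
  have h1 : (l a).re = ∫ ω, (l (h ω)).re ∂μ := by
    rw [← (ha l).2]
    exact (integral_re (ha l).1).symm
  have h2 : 0 ≤ ∫ ω, (l (h ω)).re ∂μ :=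
    integral_nonneg_of_ae (hh.mono fun ω hω => hpos _ hω)
  simp only [RCLike.re_to_complex] at hu
  linarith

theorem HasIntegral.mono_set {h : Ω → A} {a b : A} {s : Set Ω} (hs : MeasurableSet s)
    (ha : HasIntegral μ h a) (hb : HasIntegral (μ.restrict s) h b)
    (hh : ∀ ω, 0 ≤ h ω) : b ≤ a :=
  sub_nonneg.1 ((ha.of_compl hs hb).nonneg (ae_of_all _ hh))

/-- The Cauchy–Schwarz inequality for `∫ φ ψ^*`. -/
theorem norm_integral_mul_star_sq_le {φ ψ : Ω → A} {p q r : A}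
    (hp : HasIntegral μ (fun ω => φ ω * star (φ ω)) p)
    (hq : HasIntegral μ (fun ω => φ ω * star (ψ ω)) q)
    (hr : HasIntegral μ (fun ω => ψ ω * star (ψ ω)) r) : ‖q‖ ^ 2 ≤ ‖p‖ * ‖r‖ := by
  have hp0 : 0 ≤ p := hp.nonneg (ae_of_all _ fun ω => mul_star_self_nonneg _)
  have hr0 : 0 ≤ r := hr.nonneg (ae_of_all _ fun ω => mul_star_self_nonneg _)
  -- A strict bound keeps `M` positive, hence cancellable, even when `p = 0`.
  have key : ∀ M : ℝ, ‖p‖ < M → ‖q‖ ^ 2 ≤ M * ‖r‖ := by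
    intro M hM
    have hM0 : 0 < M := (norm_nonneg _).trans_lt hM
    set x : A := star q
    -- This is the integral of `(xφ - Mψ)(xφ - Mψ)^*`; the choice `x = q^*` makes both cross terms
    -- `-M q^* q`.
    have hI : 0 ≤ x * p * star x - M • (x * q) - M • (star q * star x) + (M * M) • r := by
      have h1 := (hp.const_mul x).mul_const (star x)
      have h2 := (hq.const_mul x).map (M • ContinuousLinearMap.id ℂ A)
      have h3 := (hq.star.mul_const (star x)).map (M • ContinuousLinearMap.id ℂ A)
      have h4 := hr.map ((M * M) • ContinuousLinearMap.id ℂ A)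
      have := ((h1.sub h2).sub h3).add h4
      refine HasIntegral.nonneg this (ae_of_all _ fun ω => ?_)
      have e := mul_star_self_nonneg (x * φ ω - M • ψ ω)
      convert! e using 1
      simp only [star_sub, star_mul, star_smul, mul_sub, sub_mul, mul_smul_comm, smul_mul_assoc,
        _root_.smul_apply, ContinuousLinearMap.id_apply, star_star, mul_assoc,
        smul_smul, star_trivial, smul_sub]
      abel
    have hx : x * p * star x ≤ M • (x * star x) := by
      calc x * p * star x ≤ ‖p‖ • (x * star x) := CStarAlgebra.star_right_conjugate_le_norm_smul
        _ ≤ M • (x * star x) := smul_le_smul_of_nonneg_right hM.le (mul_star_self_nonneg _)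
    have h5 : M • (star q * q) ≤ M • (M • r) := by
      have h6 : (0 : A) ≤ M • (x * star x) - M • (x * q) - M • (star q * star x) + (M * M) • r :=
        hI.trans (by gcongr)
      simp only [x, star_star, sub_self, zero_sub] at h6
      rw [smul_smul]
      simpa using h6
    have h7 : star q * q ≤ M • r := (smul_le_smul_iff_of_pos_left hM0).1 h5
    calc ‖q‖ ^ 2 = ‖star q * q‖ := by rw [CStarRing.norm_star_mul_self, sq]
      _ ≤ ‖M • r‖ := CStarAlgebra.norm_le_norm_of_nonneg_of_le (star_mul_self_nonneg q) h7
      _ = M * ‖r‖ := by rw [norm_smul, Real.norm_of_nonneg hM0.le]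
  refine ge_of_tendsto' (x := atTop)
    (f := fun n : ℕ => (‖p‖ + 1 / ((n : ℝ) + 1)) * ‖r‖) ?_ fun n => ?_
  · simpa using (tendsto_const_nhds.add tendsto_one_div_add_atTop_nhds_zero_nat).mul_const ‖r‖
  · exact key _ (lt_add_of_pos_right _ (by positivity))

/-- Monotone approximation: the weak integrals of a positive function over an exhausting
sequence of sets converge in norm. -/
theorem HasIntegral.tendsto_of_monotone {h : Ω → A} {a : A} (ha : HasIntegral μ h a)
    (hh : ∀ ω, 0 ≤ h ω) {E : ℕ → Set Ω} (hE : ∀ n, MeasurableSet (E n)) (hmono : Monotone E)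
    (hU : ⋃ n, E n = Set.univ) {b : ℕ → A}
    (hb : ∀ n, HasIntegral (μ.restrict (E n)) h (b n)) : Tendsto b atTop (𝓝 a) := by
  have hba : ∀ n, b n ≤ a := fun n => ha.mono_set (hE n) (hb n) hh
  have hbm : Monotone b := fun m n hmn => by
    refine HasIntegral.mono_set (μ := μ.restrict (E n)) (hE m) (hb n) ?_ hh
    rw [Measure.restrict_restrict (hE m), Set.inter_eq_left.2 (hmono hmn)]
    exact hb m
  -- Mazur's argument: `b` tends to `a` weakly, so `a` lies in the norm closure of this convex set.
  -- A point `x ≤ b N` near `a` then gives `0 ≤ a - b n ≤ a - x` for all `n ≥ N`.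
  let s : Set A := {x | ∃ N, x ≤ b N}
  have hs : Convex ℝ s := by
    rintro x ⟨N, hN⟩ y ⟨M, hM⟩ u v hu hv huv
    refine ⟨max N M, ?_⟩
    calc u • x + v • y ≤ u • b (max N M) + v • b (max N M) := by
          gcongr
          · exact hN.trans (hbm (le_max_left _ _))
          · exact hM.trans (hbm (le_max_right _ _))
      _ = b (max N M) := by rw [← add_smul, huv, one_smul]
  have hmem : a ∈ closure s := by
    by_contra hn
    obtain ⟨l, u, hl, hu⟩ := RCLike.geometric_hahn_banach_closed_point (𝕜 := ℂ)
      hs.closure isClosed_closure hn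
    have ht : Tendsto (fun n => l (b n)) atTop (𝓝 (l a)) := by
      have := tendsto_setIntegral_of_monotone (μ := μ) (f := fun ω => l (h ω)) hE hmono
        (ha l).1.integrableOn
      rw [hU, setIntegral_univ, (ha l).2] at this
      exact this.congr fun n => (hb n l).2
    have ht' := (Complex.continuous_re.tendsto _).comp ht
    have : (l a).re ≤ u := le_of_tendsto' ht' fun n =>
      (hl (b n) (subset_closure ⟨n, le_rfl⟩)).le
    exact absurd hu (not_lt.2 this)
  refine Metric.tendsto_atTop.2 fun ε hε => ?_
  obtain ⟨x, ⟨N, hN⟩, hx⟩ := Metric.mem_closure_iff.1 hmem ε hε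
  refine ⟨N, fun n hn => ?_⟩
  rw [dist_eq_norm] at hx
  rw [dist_comm, dist_eq_norm]
  refine lt_of_le_of_lt (CStarAlgebra.norm_le_norm_of_nonneg_of_le (sub_nonneg.2 (hba n)) ?_) hx
  exact sub_le_sub_left (hN.trans (hbm hn)) a

end Integrals

/-- A unimodular `s` with `s(z) z = |z|`. -/
theorem exists_unimodular :
    ∃ s : ℂ → ℂ, Measurable s ∧ ∀ z, s z * star (s z) = 1 ∧ s z * z = (‖z‖ : ℂ) := by
  classical
  refine ⟨fun z => if z = 0 then 1 else star z / (‖z‖ : ℂ), ?_, fun z => ?_⟩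
  · refine Measurable.ite (measurableSet_singleton 0) measurable_const ?_
    exact (continuous_star.measurable).div (Complex.measurable_ofReal.comp measurable_norm)
  · by_cases hz : z = 0
    · simp [hz]
    · have hn : (‖z‖ : ℂ) ≠ 0 := by simpa using hz
      have hzz : (starRingEnd ℂ) z * z = (‖z‖ : ℂ) ^ 2 := Complex.conj_mul' z
      simp only [hz, if_false, star_div₀, RCLike.star_def, Complex.conj_conj, Complex.conj_ofReal]
      constructor
      · rw [div_mul_div_comm, hzz, sq, div_self (mul_ne_zero hn hn)]
      · rw [div_mul_eq_mul_div, hzz, sq, mul_div_assoc, div_self hn, mul_one]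

/-! ### σ-finite supports of square-integrable functions -/

section Support

variable {Ω A : Type*} [MeasurableSpace Ω] {μ : Measure Ω} [CStarAlgebra A]

/-- An integral over `E ∩ S` is an integral over `E` if the integrand vanishes off `S`. -/
theorem HasIntegral.of_inter {h : Ω → A} {a : A} {E S : Set Ω} (hE : MeasurableSet E)
    (hS : MeasurableSet S) (h0 : ∀ᵐ ω ∂μ, ω ∉ S → h ω = 0)
    (ha : HasIntegral (μ.restrict (E ∩ S)) h a) : HasIntegral (μ.restrict E) h a := by
  have hz : HasIntegral (μ.restrict (E \ S)) h 0 := by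
    refine HasIntegral.zero.congr_ae ?_
    filter_upwards [ae_restrict_mem (hE.diff hS), ae_restrict_of_ae h0] with ω h1 h2
    exact (h2 h1.2).symm
  simpa [Set.inter_union_sdiff] using
    ha.union hz (Set.disjoint_left.2 fun ω h1 h2 => h2.2 h1.2) (hE.diff hS)

/-- A function in `L²` vanishes off the union of an increasing sequence of sets of finite
measure. -/
theorem exists_exhaustion {φ : Ω → A} (hφ : φ ∈ L2 A μ) :
    ∃ (S : Set Ω) (E : ℕ → Set Ω), MeasurableSet S ∧ (∀ᵐ ω ∂μ, ω ∉ S → φ ω = 0) ∧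
      (∀ n, MeasurableSet (E n)) ∧ Monotone E ∧ ⋃ n, E n = Set.univ ∧
      ∀ n, μ (E n ∩ S) < ⊤ := by
  obtain ⟨hm, a, ha⟩ := hφ
  obtain ⟨D, hD, hDf, h0⟩ := ha.exists_sigmaFinite_support (hm.mul hm.star)
  have hS : MeasurableSet (⋃ n, D n) := MeasurableSet.iUnion hD
  -- Adding the complement of the support makes the sets exhaust `Ω` although `μ` need not be
  -- σ-finite.
  refine ⟨⋃ n, D n, fun n => Set.accumulate D n ∪ (⋃ n, D n)ᶜ, hS, ?_, ?_, ?_, ?_, ?_⟩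
  · exact h0.mono fun ω hω hn => CStarRing.mul_star_self_eq_zero_iff _ |>.1 (hω hn)
  · exact fun n => (MeasurableSet.biUnion (Set.to_countable _) fun i _ => hD i).union hS.compl
  · exact fun m n hmn => Set.union_subset_union_left _ (Set.monotone_accumulate hmn)
  · rw [← Set.iUnion_union, Set.iUnion_accumulate, Set.union_compl_self]
  · intro n
    rw [Set.union_inter_distrib_right, Set.compl_inter_self, Set.union_empty]
    exact (measure_mono Set.inter_subset_left).trans_lt
      (measure_biUnion_lt_top (Set.finite_Iic n) fun i _ => hDf i)

end Support

/-! ### Vector integrals and passage to the whole space -/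

section Frames

variable {Ω A U : Type*} [MeasurableSpace Ω] {μ : Measure Ω}
  [CStarAlgebra A] [PartialOrder A]
  [NormedAddCommGroup U] [NormedSpace ℂ U] [Module A U] [CStarModule A U]

theorem eq_of_forall_ip_eq {u v : U} (h : ∀ f : U, ip A u f = ip A v f) : u = v := by
  rw [← sub_eq_zero, ← CStarModule.inner_self (A := A) (x := u - v)]
  have := h (u - v)
  simp only [ip] at this
  rw [CStarModule.inner_sub_right, this, sub_self]

theorem star_ip (f g : U) : star (ip A f g) = ip A g f := CStarModule.star_inner _ _

theorem HasVectorIntegral.unique {φ : Ω → A} {F : Ω → U} {u v : U}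
    (hu : HasVectorIntegral μ φ F u) (hv : HasVectorIntegral μ φ F v) : u = v :=
  eq_of_forall_ip_eq fun f => (hu f).unique (hv f)

theorem HasVectorIntegral.congr_ae {φ ψ : Ω → A} {F : Ω → U} {u : U}
    (hu : HasVectorIntegral μ φ F u) (h : φ =ᵐ[μ] ψ) : HasVectorIntegral μ ψ F u := fun f =>
  (hu f).congr_ae (h.mono fun ω hω => by simp only [hω])

theorem HasVectorIntegral.sub {φ ψ : Ω → A} {F : Ω → U} {u v : U}
    (hu : HasVectorIntegral μ φ F u) (hv : HasVectorIntegral μ ψ F v) :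
    HasVectorIntegral μ (φ - ψ) F (u - v) := fun f => by
  have := (hu f).sub (hv f)
  simpa [ip, sub_mul] using this

theorem HasVectorIntegral.union {φ : Ω → A} {F : Ω → U} {u v : U} {s t : Set Ω}
    (hu : HasVectorIntegral (μ.restrict s) φ F u) (hv : HasVectorIntegral (μ.restrict t) φ F v)
    (hst : Disjoint s t) (ht : MeasurableSet t) :
    HasVectorIntegral (μ.restrict (s ∪ t)) φ F (u + v) := fun f => by
  have := (hu f).union (hv f) hst ht
  simpa [ip] using this

theorem synthesis_eq {φ : Ω → A} {F : Ω → U} {u : U} (hu : HasVectorIntegral μ φ F u) :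
    synthesis μ F φ = u := by
  have h : ∃ u : U, HasVectorIntegral μ φ F u := ⟨u, hu⟩
  rw [synthesis, dif_pos h]
  exact h.choose_spec.unique hu

/-- The two-sided estimate in the definition of a continuous Riesz basis, on one set. -/
def RieszBoundsOn (μ : Measure Ω) (F : Ω → U) (φ : Ω → A) (α β : ℝ) (E : Set Ω) : Prop :=
  ∃ (a : A) (u : U),
    HasIntegral (μ.restrict E) (fun ω => φ ω * star (φ ω)) a ∧
    HasVectorIntegral (μ.restrict E) φ F u ∧ α * √‖a‖ ≤ ‖u‖ ∧ ‖u‖ ≤ β * √‖a‖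

/-- Carries the bounds to exhausting sets that may have infinite measure. -/
theorem RieszBoundsOn.of_inter {F : Ω → U} {φ : Ω → A} {α β : ℝ} {E S : Set Ω}
    (hE : MeasurableSet E) (hS : MeasurableSet S) (h0 : ∀ᵐ ω ∂μ, ω ∉ S → φ ω = 0)
    (h : RieszBoundsOn μ F φ α β (E ∩ S)) : RieszBoundsOn μ F φ α β E := by
  obtain ⟨a, u, ha, hu, h1, h2⟩ := h
  refine ⟨a, u, ha.of_inter hE hS ?_, fun f => (hu f).of_inter hE hS ?_, h1, h2⟩
  · exact h0.mono fun ω hω hn => by simp [hω hn]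
  · exact h0.mono fun ω hω hn => by simp [hω hn]

theorem WeaklyMeasurable.aestronglyMeasurable_ip {F : Ω → U} (hw : WeaklyMeasurable A μ F)
    (f : U) : AEStronglyMeasurable (fun ω => ip A (F ω) f) μ := by
  refine (hw f).star.congr (ae_of_all _ fun ω => ?_)
  exact star_ip _ _

variable [StarOrderedRing A]

theorem norm_ip_le (f g : U) : ‖ip A f g‖ ≤ ‖f‖ * ‖g‖ :=
  (CStarModule.norm_inner_le U).trans_eq (mul_comm _ _)

theorem continuous_ip_left (f : U) : Continuous fun u : U => ip A u f :=
  (CStarModule.innerSL (A := A) f).continuous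

variable [CompleteSpace U]

/-- The weak vector integral of an `L²` function exists on the whole space, with the lower
estimate. -/
theorem exists_vectorIntegral {F : Ω → U} (hw : WeaklyMeasurable A μ F) {α β : ℝ} (hβ : 0 < β)
    (hR : ∀ φ ∈ L2 A μ, ∀ E : Set Ω, MeasurableSet E → μ E < ⊤ → RieszBoundsOn μ F φ α β E)
    {φ : Ω → A} (hφ : φ ∈ L2 A μ) {a : A} (ha : HasIntegral μ (fun ω => φ ω * star (φ ω)) a) :
    ∃ u : U, HasVectorIntegral μ φ F u ∧ α * √‖a‖ ≤ ‖u‖ := by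
  obtain ⟨S, E, hS, h0, hE, hmono, hU, hfin⟩ := exists_exhaustion hφ
  have hpos : ∀ ω, 0 ≤ φ ω * star (φ ω) := fun ω => mul_star_self_nonneg _
  have hR' : ∀ n, RieszBoundsOn μ F φ α β (E n) := fun n =>
    (hR φ hφ _ ((hE n).inter hS) (hfin n)).of_inter (hE n) hS h0
  choose b u hb hu hlow hup using hR'
  have hlim : Tendsto b atTop (𝓝 a) := ha.tendsto_of_monotone hpos hE hmono hU hb
  -- The increment `u m - u n` is the integral over `E m \ E n`, where the square integral is at
  -- most `a - b n`.
  have hdiff : ∀ n m, n ≤ m → dist (u n) (u m) ≤ β * √‖a - b n‖ := by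
    intro n m hnm
    have hd := (hE m).diff (hE n)
    obtain ⟨a', u', ha', hu', -, hup'⟩ :=
      (hR φ hφ _ (hd.inter hS) ((measure_mono (Set.inter_subset_inter_left _
        Set.sdiff_subset)).trans_lt (hfin m))).of_inter hd hS h0
    have hu2 := (hu n).union hu' Set.disjoint_sdiff_right hd
    rw [Set.union_sdiff_cancel (hmono hnm)] at hu2
    have e1 : u m = u n + u' := (hu m).unique hu2
    have hle : a' ≤ a - b n := by
      refine HasIntegral.mono_set (μ := μ.restrict (E n)ᶜ) hd (ha.of_compl (hE n) (hb n)) ?_ hpos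
      rw [Measure.restrict_restrict hd, Set.inter_eq_left.2 (fun ω hω => hω.2)]
      exact ha'
    have hnn : 0 ≤ a' := ha'.nonneg (ae_of_all _ hpos)
    rw [dist_comm, dist_eq_norm, e1, add_sub_cancel_left]
    refine hup'.trans ?_
    gcongr
    exact CStarAlgebra.norm_le_norm_of_nonneg_of_le hnn hle
  have hto0 : Tendsto (fun n => β * √‖a - b n‖) atTop (𝓝 0) := by
    have h1 : Tendsto (fun n => β * √‖a - b n‖) atTop (𝓝 (β * √‖a - a‖)) :=
      ((tendsto_const_nhds.sub hlim).norm.sqrt).const_mul β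
    simpa using h1
  obtain ⟨v, hv⟩ := cauchySeq_tendsto_of_complete (cauchySeq_of_le_tendsto_0' _
    hdiff hto0 : CauchySeq u)
  refine ⟨v, fun f l => ?_, ?_⟩
  · set g : Ω → ℂ := fun ω => l (φ ω * ip A (F ω) f) with hg
    have hgm : AEStronglyMeasurable g μ :=
      l.continuous.comp_aestronglyMeasurable (hφ.1.mul (hw.aestronglyMeasurable_ip f))
    have hcov : AECover μ atTop E :=
      { ae_eventually_mem := ae_of_all _ fun ω => by
          obtain ⟨n, hn⟩ := Set.mem_iUnion.1 (hU.symm ▸ Set.mem_univ ω : ω ∈ ⋃ n, E n)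
          exact (eventually_ge_atTop n).mono fun m hm => hmono hm hn
        measurableSet := hE }
    have hgi : ∀ n, IntegrableOn g (E n) μ := fun n => (hu n f l).1
    -- Multiplying `φ` by a unimodular function keeps `φ φ^*` and turns the scalar integrand into
    -- `|g|`, so the upper Riesz bound controls the `L¹` norms of `g` uniformly in `n`.
    obtain ⟨s, hs, hs'⟩ := exists_unimodular
    have hsq : ∀ ω, (s (g ω) • φ ω) * star (s (g ω) • φ ω) = φ ω * star (φ ω) := fun ω => by
      rw [star_smul, smul_mul_smul_comm, (hs' (g ω)).1, one_smul]
    have hφ' : (fun ω => s (g ω) • φ ω) ∈ L2 A μ := by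
      refine ⟨?_, a, by simpa only [hsq] using ha⟩
      exact (hs.comp_aemeasurable hgm.aemeasurable).aestronglyMeasurable.smul hφ.1
    have hbd : ∀ n, ∫ ω in E n, ‖g ω‖ ∂μ ≤ ‖l‖ * (β * √‖a‖ * ‖f‖) := by
      intro n
      obtain ⟨a', u', ha', hu', -, hup'⟩ :=
        (hR _ hφ' _ ((hE n).inter hS) (hfin n)).of_inter (hE n) hS
          (h0.mono fun ω hω hn => by simp [hω hn])
      simp only [hsq] at ha'
      have ha'0 : 0 ≤ a' := ha'.nonneg (ae_of_all _ hpos)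
      have h1 := (hu' f l).2
      have h2 : ∀ ω, l (s (g ω) • φ ω * ip A (F ω) f) = (‖g ω‖ : ℂ) := fun ω => by
        rw [smul_mul_assoc, map_smul, smul_eq_mul]
        exact (hs' (g ω)).2
      simp only [h2] at h1
      rw [integral_complex_ofReal] at h1
      calc ∫ ω in E n, ‖g ω‖ ∂μ = ‖((∫ ω in E n, ‖g ω‖ ∂μ : ℝ) : ℂ)‖ := by
            rw [Complex.norm_real, Real.norm_of_nonneg]
            exact integral_nonneg fun ω => norm_nonneg _
        _ = ‖l (ip A u' f)‖ := by rw [h1]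
        _ ≤ ‖l‖ * ‖ip A u' f‖ := l.le_opNorm _
        _ ≤ ‖l‖ * (‖u'‖ * ‖f‖) := by gcongr; exact norm_ip_le _ _
        _ ≤ ‖l‖ * (β * √‖a‖ * ‖f‖) := by
            gcongr
            refine hup'.trans ?_
            gcongr
            exact CStarAlgebra.norm_le_norm_of_nonneg_of_le ha'0 (ha.mono_set (hE n) ha' hpos)
    have hint : Integrable g μ :=
      hcov.integrable_of_integral_norm_bounded _ hgi (Eventually.of_forall hbd)
    refine ⟨hint, ?_⟩
    have t1 := hcov.integral_tendsto_of_countably_generated hint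
    have t2 : Tendsto (fun n => l (ip A (u n) f)) atTop (𝓝 (l (ip A v f))) :=
      (l.continuous.tendsto _).comp (((continuous_ip_left f).tendsto v).comp hv)
    exact tendsto_nhds_unique t1 (t2.congr fun n => ((hu n f l).2).symm)
  · exact le_of_tendsto_of_tendsto' ((hlim.norm.sqrt).const_mul α) hv.norm hlow

end Frames

/-! ### Adjointable maps and a surjectivity criterion -/

section Operators

variable {A U : Type*} [CStarAlgebra A] [PartialOrder A]
  [NormedAddCommGroup U] [NormedSpace ℂ U] [Module A U] [CStarModule A U]

theorem norm_ip_self (f : U) : ‖ip A f f‖ = ‖f‖ ^ 2 := (CStarModule.norm_sq_eq A).symm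

theorem IsAdjoint.symm {T T' : U → U} (h : IsAdjoint A T T') : IsAdjoint A T' T := fun f g => by
  rw [← star_ip, ← h g f, star_ip]

variable [StarOrderedRing A] [CompleteSpace U]

/-- An adjointable map is linear and bounded. -/
theorem IsAdjoint.exists_clm {T T' : U → U} (h : IsAdjoint A T T') :
    ∃ S : U →L[ℂ] U, ∀ f, S f = T f := by
  let S : U →ₗ[ℂ] U :=
    { toFun := T
      map_add' := fun f g => eq_of_forall_ip_eq (A := A) fun k => by
        have h1 := h f k
        have h2 := h g k
        have h3 := h (f + g) k
        simp only [ip] at *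
        rw [h3, CStarModule.inner_add_right, CStarModule.inner_add_right, h1, h2]
      map_smul' := fun c f => eq_of_forall_ip_eq (A := A) fun k => by
        have h1 := h f k
        have h3 := h (c • f) k
        simp only [ip, RingHom.id_apply] at *
        rw [h3, CStarModule.inner_smul_right_complex, CStarModule.inner_smul_right_complex, h1] }
  -- The graph is closed because pairing with `k` can be moved onto `T' k`.
  refine ⟨ContinuousLinearMap.ofSeqClosedGraph (g := S) fun u x y hu hTu => ?_, fun f => rfl⟩
  refine eq_of_forall_ip_eq (A := A) fun k => ?_
  have h1 : Tendsto (fun n => ip A (T (u n)) k) atTop (𝓝 (ip A y k)) :=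
    ((continuous_ip_left k).tendsto y).comp hTu
  have h2 : Tendsto (fun n => ip A (T (u n)) k) atTop (𝓝 (ip A (T x) k)) := by
    rw [h x k]
    exact (((continuous_ip_left (T' k)).tendsto x).comp hu).congr fun n => (h (u n) k).symm
  exact tendsto_nhds_unique h1 h2

/-- If `‖(R + t) v‖ ≥ c ‖v‖` for all `t ≥ 0`, then `R` is invertible. -/
theorem isUnit_of_forall_norm_le {V : Type*} [NormedAddCommGroup V] [NormedSpace ℂ V]
    [CompleteSpace V] (R : V →L[ℂ] V) {c : ℝ} (hc : 0 < c)
    (h : ∀ t : ℝ, 0 ≤ t → ∀ v, c * ‖v‖ ≤ ‖R v + t • v‖) : IsUnit R := by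
  -- Continuity method: the inverse at `t` has norm at most `c⁻¹`, so a Neumann series allows a step
  -- `c / 2` independent of `t`.
  have step : ∀ t t' : ℝ, 0 ≤ t → |t - t'| ≤ c / 2 → IsUnit (R + t • 1) →
      IsUnit (R + t' • 1) := by
    rintro t t' ht htt ⟨x, hx⟩
    have hinv : ‖(↑x⁻¹ : V →L[ℂ] V)‖ ≤ c⁻¹ := by
      refine ContinuousLinearMap.opNorm_le_bound _ (by positivity) fun v => ?_
      have h1 := h t ht ((↑x⁻¹ : V →L[ℂ] V) v)
      have h2 : R ((↑x⁻¹ : V →L[ℂ] V) v) + t • (↑x⁻¹ : V →L[ℂ] V) v = v := by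
        have : ((x : V →L[ℂ] V) * ↑x⁻¹) v = v := by simp
        rw [hx] at this
        simpa using this
      rw [h2] at h1
      rwa [inv_mul_eq_div, le_div_iff₀' hc]
    have hlt : ‖(t - t') • (↑x⁻¹ : V →L[ℂ] V)‖ < 1 := by
      rw [norm_smul, Real.norm_eq_abs]
      calc |t - t'| * ‖(↑x⁻¹ : V →L[ℂ] V)‖ ≤ c / 2 * c⁻¹ := by gcongr
        _ < 1 := by field_simp; norm_num
    have hu := x.isUnit.mul (Units.oneSub _ hlt).isUnit
    convert hu using 1
    rw [Units.val_oneSub, mul_sub, mul_one, mul_smul_comm, Units.mul_inv, hx, sub_smul]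
    abel
  set t₀ : ℝ := ‖R‖ + 1
  have ht₀ : 0 < t₀ := by positivity
  have h0 : IsUnit (R + t₀ • 1) := by
    have hlt : ‖-(t₀⁻¹ • R)‖ < 1 := by
      rw [norm_neg, norm_smul, norm_inv, Real.norm_of_nonneg ht₀.le, inv_mul_lt_iff₀ ht₀]
      simp [t₀]
    have hu := (Units.oneSub _ hlt).isUnit
    have hs := hu.smul (Units.mk0 t₀ ht₀.ne')
    convert hs using 1
    rw [Units.val_oneSub, sub_neg_eq_add, Units.smul_mk0, smul_add, smul_inv_smul₀ ht₀.ne',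
      add_comm]
  -- Descent from `t₀ > ‖R‖` to `0` in steps of `c / 2`; truncation keeps the parameter where the
  -- lower bound is available.
  have hn : ∀ n : ℕ, IsUnit (R + max (t₀ - n * (c / 2)) 0 • 1) := by
    intro n
    induction n with
    | zero => simpa [max_eq_left ht₀.le] using h0
    | succ n ih =>
      refine step _ _ (le_max_right _ _) ?_ ih
      refine (abs_max_sub_max_le_abs _ _ _).trans ?_
      rw [abs_le]
      push_cast
      constructor <;> linarith
  obtain ⟨n, hn'⟩ := exists_nat_ge (t₀ / (c / 2))
  have h1 := hn n
  rw [div_le_iff₀ (by positivity)] at hn'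
  rwa [max_eq_right (by linarith), zero_smul, add_zero] at h1

/-- A positive injective operator that is bounded below on its range is surjective. -/
theorem surjective_of_bounded_below_on_range (S : U →L[ℂ] U) {c : ℝ} (hc : 0 < c)
    (hpos : ∀ f, 0 ≤ ip A (S f) f) (hinj : Function.Injective S)
    (hlow : ∀ f, c * ‖S f‖ ^ 2 ≤ ‖ip A (S (S f)) (S f)‖) : Function.Surjective S := by
  set V : Submodule ℂ U := (LinearMap.range (S : U →ₗ[ℂ] U)).topologicalClosure with hV
  have hSV : ∀ f, S f ∈ V := fun f => subset_closure ⟨f, rfl⟩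
  have : CompleteSpace V :=
    (Submodule.isClosed_topologicalClosure _).completeSpace_coe
  -- The lower bound extends by continuity to the closure of the range.
  have hlowV : ∀ v ∈ V, c * ‖v‖ ^ 2 ≤ ‖ip A (S v) v‖ := by
    intro v hv
    have hcl : IsClosed {v : U | c * ‖v‖ ^ 2 ≤ ‖ip A (S v) v‖} := by
      refine isClosed_le (by fun_prop) ?_
      exact ((CStarModule.continuous_inner (A := A)).comp
        (continuous_id.prodMk S.continuous)).norm
    refine closure_minimal ?_ hcl hv
    rintro _ ⟨f, rfl⟩
    exact hlow f
  let R : V →L[ℂ] V := (S.comp V.subtypeL).codRestrict V fun v => hSV _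
  have hR : IsUnit R := by
    refine isUnit_of_forall_norm_le R hc fun t ht v => ?_
    rcases eq_or_ne ‖v‖ 0 with h0 | h0
    · rw [h0, mul_zero]; exact norm_nonneg _
    have hv : 0 < ‖v‖ := lt_of_le_of_ne (norm_nonneg _) h0.symm
    -- Positivity: adding `t ⟨v, v⟩` to `⟨S v, v⟩` can only increase the norm.
    have h1 : ‖ip A (S v) (v : U)‖ ≤ ‖ip A (S v + t • (v : U)) (v : U)‖ := by
      refine CStarAlgebra.norm_le_norm_of_nonneg_of_le (hpos _) ?_
      simp only [ip, CStarModule.inner_add_right, CStarModule.inner_smul_right_real]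
      exact le_add_of_nonneg_right (smul_nonneg ht CStarModule.inner_self_nonneg)
    have h2 := (hlowV v v.2).trans (h1.trans (norm_ip_le (A := A) _ _))
    rw [sq, ← mul_assoc] at h2
    exact le_of_mul_le_mul_right h2 hv
  have hRs : ∀ w : V, ∃ v : V, R v = w := by
    obtain ⟨x, hx⟩ := hR
    intro w
    refine ⟨(↑x⁻¹ : V →L[ℂ] V) w, ?_⟩
    rw [← hx, ← mul_apply_eq_comp, Units.mul_inv, one_apply_eq_self]
  intro f
  obtain ⟨v, hv⟩ := hRs ⟨S f, hSV f⟩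
  -- `S f = S v` with `v ∈ V`, so injectivity puts `f` in `V`: the range is dense, and `R` is `S`
  -- itself.
  have hfV : f ∈ V := hinj (congrArg Subtype.val hv : S v = S f) ▸ v.2
  obtain ⟨w, hw⟩ := hRs ⟨f, hfV⟩
  exact ⟨w, congrArg Subtype.val hw⟩

end Operators

/-! ### Bijectivity of the mixed operators -/

section RieszBasis

variable {Ω A U : Type*} [MeasurableSpace Ω] {μ : Measure Ω}
  [CStarAlgebra A] [PartialOrder A]
  [NormedAddCommGroup U] [NormedSpace ℂ U] [Module A U] [CStarModule A U]

theorem analysis_mul_star {Ω : Type*} (F : Ω → U) (f : U) (ω : Ω) :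
    analysis A F f ω * star (analysis A F f ω) = ip A f (F ω) * ip A (F ω) f := by
  rw [analysis, star_ip]

theorem IsBessel.analysis_mem {F : Ω → U} (hF : IsBessel A μ F) (f : U) :
    analysis A F f ∈ L2 A μ := by
  obtain ⟨hw, β, -, h⟩ := hF
  obtain ⟨a, ha, -⟩ := h f
  exact ⟨hw f, a, by simpa only [analysis_mul_star] using ha⟩

theorem IsContinuousRieszBasis.analysis_mem {F : Ω → U}
    (hF : IsContinuousRieszBasis A μ F) (f : U) : analysis A F f ∈ L2 A μ :=
  hF.2.1.1.analysis_mem f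

theorem IsContinuousRieszBasis.eq_of_analysis_ae_eq {F : Ω → U} (hF : IsContinuousRieszBasis A μ F) {f g : U}
    (h : analysis A F f =ᵐ[μ] analysis A F g) : f = g := by
  refine sub_eq_zero.1 (hF.2.1.2 _ (h.mono fun ω hω => ?_))
  simp only [analysis, ip] at hω ⊢
  rw [CStarModule.inner_sub_right, hω, sub_self]

variable [StarOrderedRing A] [CompleteSpace U] {F G : Ω → U}

namespace IsContinuousRieszBasis

theorem exists_lower_bound (hF : IsContinuousRieszBasis A μ F) : ∃ α : ℝ, 0 < α ∧
    ∀ φ ∈ L2 A μ, ∀ a, HasIntegral μ (fun ω => φ ω * star (φ ω)) a →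
      HasVectorIntegral μ φ F (synthesis μ F φ) ∧ α * √‖a‖ ≤ ‖synthesis μ F φ‖ := by
  obtain ⟨hw, -, α, β, hα, hβ, hR⟩ := hF
  refine ⟨α, hα, fun φ hφ a ha => ?_⟩
  obtain ⟨u, hu, hle⟩ := exists_vectorIntegral hw hβ hR hφ ha
  rw [synthesis_eq hu]
  exact ⟨hu, hle⟩

theorem hasVectorIntegral (hF : IsContinuousRieszBasis A μ F) {φ : Ω → A} (hφ : φ ∈ L2 A μ) :
    HasVectorIntegral μ φ F (synthesis μ F φ) := by
  obtain ⟨α, -, h⟩ := hF.exists_lower_bound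
  obtain ⟨a, ha⟩ := hφ.2
  exact (h φ hφ a ha).1

/-- The lower bound forces `∫ φ φ^* = 0`; by monotonicity the integral over each set of finite
measure vanishes too, hence so does `φ φ^*` a.e. -/
theorem ae_eq_zero_of_synthesis_eq_zero (hF : IsContinuousRieszBasis A μ F) {φ : Ω → A}
    (hφ : φ ∈ L2 A μ) (h : synthesis μ F φ = 0) : φ =ᵐ[μ] 0 := by
  obtain ⟨α, hα, hlow⟩ := hF.exists_lower_bound
  obtain ⟨a, ha⟩ := hφ.2
  have hpos : ∀ ω, 0 ≤ φ ω * star (φ ω) := fun ω => mul_star_self_nonneg _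
  have ha0 : a = 0 := by
    have h1 := (hlow φ hφ a ha).2
    rw [h, norm_zero] at h1
    have h2 : √‖a‖ = 0 := le_antisymm (nonpos_of_mul_nonpos_right h1 hα) (Real.sqrt_nonneg _)
    simpa using h2
  have hz := ha.ae_eq_zero (hφ.1.mul hφ.1.star) fun s hs hμ => by
    obtain ⟨_, _, _, _, _, _, hR⟩ := hF
    obtain ⟨b, -, hb, -⟩ := hR φ hφ s hs hμ
    have hb0 : b = 0 := le_antisymm (ha0 ▸ ha.mono_set hs hb hpos)
      (hb.nonneg (ae_of_all _ hpos))
    exact hb0 ▸ hb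
  exact hz.mono fun ω hω => (CStarRing.mul_star_self_eq_zero_iff _).1 hω

/-- The synthesis operator is injective: comparison with a function in the range of the
analysis operator of any Riesz basis `G`. -/
theorem ae_eq_analysis (hF : IsContinuousRieszBasis A μ F) {φ : Ω → A} (hφ : φ ∈ L2 A μ)
    (hG : IsContinuousRieszBasis A μ G) (f : U)
    (h : synthesis μ F φ = synthesis μ F (analysis A G f)) : φ =ᵐ[μ] analysis A G f := by
  set ψ := analysis A G f
  have hψ : ψ ∈ L2 A μ := hG.analysis_mem f
  obtain ⟨a, ha⟩ := hφ.2
  obtain ⟨b, hb⟩ := hψ.2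
  -- The mixed integral exists because `ψ` is an analysis function: it equals `⟨T_G φ, f⟩`. This is
  -- what puts `φ - ψ` in `L²`.
  have hc : HasIntegral μ (fun ω => φ ω * star (ψ ω)) (ip A (synthesis μ G φ) f) := by
    simpa only [ψ, analysis, star_ip] using hG.hasVectorIntegral hφ f
  have hδ : φ - ψ ∈ L2 A μ := by
    refine ⟨hφ.1.sub hψ.1, _, (((ha.sub hc).sub hc.star).add hb).congr_ae
      (ae_of_all _ fun ω => ?_)⟩
    simp only [Pi.sub_apply, star_sub, star_mul, star_star, mul_sub, sub_mul]
    abel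
  have h0 : synthesis μ F (φ - ψ) = 0 := by
    rw [synthesis_eq ((hF.hasVectorIntegral hφ).sub (hF.hasVectorIntegral hψ)), h, sub_self]
  exact (hF.ae_eq_zero_of_synthesis_eq_zero hδ h0).mono fun ω hω => sub_eq_zero.1 hω

theorem isAdjoint (hF : IsContinuousRieszBasis A μ F) (hG : IsContinuousRieszBasis A μ G) :
    IsAdjoint A (fun f => synthesis μ G (analysis A F f))
      (fun f => synthesis μ F (analysis A G f)) := fun f g => by
  rw [← star_ip (synthesis μ F (analysis A G g)) f]
  refine (hG.hasVectorIntegral (hF.analysis_mem f) g).unique ?_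
  refine (hF.hasVectorIntegral (hG.analysis_mem g) f).star.congr_ae (ae_of_all _ fun ω => ?_)
  simp only [analysis, star_mul, star_ip]

theorem injective (hF : IsContinuousRieszBasis A μ F) (hG : IsContinuousRieszBasis A μ G) :
    Function.Injective fun f => synthesis μ G (analysis A F f) := fun f g h =>
  hF.eq_of_analysis_ae_eq (hG.ae_eq_analysis (hF.analysis_mem f) hF g h)

/-- With `S = S_F`, the lower bound gives `α² ‖⟨Sf, f⟩‖ ≤ ‖Sf‖²`, and Cauchy–Schwarz gives `‖Sf‖⁴ ≤
‖⟨Sf, f⟩‖ ‖⟨S(Sf), Sf⟩‖`. Together they bound `S` below on its range with constant `α²`. -/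
theorem frame_surjective (hF : IsContinuousRieszBasis A μ F) :
    Function.Surjective fun f => synthesis μ F (analysis A F f) := by
  obtain ⟨S, hS⟩ := (hF.isAdjoint hF).exists_clm
  have hSI : ∀ f, HasIntegral μ (fun ω => analysis A F f ω * star (analysis A F f ω))
      (ip A (S f) f) := fun f => by
    have := hF.hasVectorIntegral (hF.analysis_mem f) f
    rw [← hS] at this
    simpa only [analysis, star_ip] using this
  obtain ⟨α, hα, hlow⟩ := hF.exists_lower_bound
  have key : Function.Surjective S := by
    refine surjective_of_bounded_below_on_range (A := A) S (pow_pos hα 2)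
      (fun f => (hSI f).nonneg (ae_of_all _ fun ω => mul_star_self_nonneg _))
      (fun f g h => hF.injective hF (by simpa only [hS] using h)) fun f => ?_
    have h1 := (hlow _ (hF.analysis_mem f) _ (hSI f)).2
    rw [← hS] at h1
    have hq : HasIntegral μ (fun ω => analysis A F f ω * star (analysis A F (S f) ω))
        (ip A (S f) (S f)) := by
      have := hF.hasVectorIntegral (hF.analysis_mem f) (S f)
      rw [← hS] at this
      simpa only [analysis, star_ip] using this
    have h2 := norm_integral_mul_star_sq_le (hSI f) hq (hSI (S f))
    rw [norm_ip_self] at h2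
    have h3 : α ^ 2 * ‖ip A (S f) f‖ ≤ ‖S f‖ ^ 2 := by
      calc α ^ 2 * ‖ip A (S f) f‖ = (α * √‖ip A (S f) f‖) ^ 2 := by
            rw [mul_pow, Real.sq_sqrt (norm_nonneg _)]
        _ ≤ ‖S f‖ ^ 2 := by gcongr
    rcases eq_or_ne ‖S f‖ 0 with h0 | h0
    · rw [h0]; simp
    have hpos : 0 < ‖S f‖ ^ 2 := by positivity
    refine le_of_mul_le_mul_right ?_ hpos
    calc α ^ 2 * ‖S f‖ ^ 2 * ‖S f‖ ^ 2 = α ^ 2 * (‖S f‖ ^ 2) ^ 2 := by ring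
      _ ≤ α ^ 2 * (‖ip A (S f) f‖ * ‖ip A (S (S f)) (S f)‖) := by gcongr
      _ = α ^ 2 * ‖ip A (S f) f‖ * ‖ip A (S (S f)) (S f)‖ := by ring
      _ ≤ ‖S f‖ ^ 2 * ‖ip A (S (S f)) (S f)‖ := by gcongr
      _ = _ := mul_comm _ _
  exact fun u => (key u).imp fun f hf => (hS f).symm.trans hf

/-- For `u = S_G g`, surjectivity of `S_F` and injectivity of `T_F` rewrite `T_G^* g` as some `T_F^*
f` a.e. -/
theorem surjective (hF : IsContinuousRieszBasis A μ F) (hG : IsContinuousRieszBasis A μ G) :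
    Function.Surjective fun f => synthesis μ G (analysis A F f) := fun u => by
  obtain ⟨g, hg⟩ := hG.frame_surjective u
  have hφ := hG.analysis_mem g
  obtain ⟨f, hf⟩ := hF.frame_surjective (synthesis μ F (analysis A G g))
  have hae := hF.ae_eq_analysis hφ hF f hf.symm
  refine ⟨f, ?_⟩
  rw [← hg]
  exact synthesis_eq ((hG.hasVectorIntegral hφ).congr_ae hae)

end IsContinuousRieszBasis

end RieszBasis

end HilbertModuleFrames

/-! ### The inverse operator and the formula for `G` -/

theorem mainTheorem6 {Ω A U : Type*} [MeasurableSpace Ω] (μ : MeasureTheory.Measure Ω)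
    [CStarAlgebra A] [PartialOrder A] [StarOrderedRing A]
    [NormedAddCommGroup U] [NormedSpace ℂ U] [CompleteSpace U] [Module A U] [CStarModule A U]
    (F G : Ω → U)
    (hF : HilbertModuleFrames.IsContinuousRieszBasis A μ F)
    (hG : HilbertModuleFrames.IsContinuousRieszBasis A μ G) :
    -- the operators `T_F`, `T_G`, `T_F^*`, `T_G^*` and `S_G` are well defined
    (∀ φ ∈ HilbertModuleFrames.L2 A μ, HilbertModuleFrames.HasVectorIntegral μ φ F
      (HilbertModuleFrames.synthesis μ F φ)) ∧
    (∀ φ ∈ HilbertModuleFrames.L2 A μ, HilbertModuleFrames.HasVectorIntegral μ φ G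
      (HilbertModuleFrames.synthesis μ G φ)) ∧
    (∀ f : U, HilbertModuleFrames.analysis A F f ∈ HilbertModuleFrames.L2 A μ) ∧
    (∀ f : U, HilbertModuleFrames.analysis A G f ∈ HilbertModuleFrames.L2 A μ) ∧
    (∀ f : U, HilbertModuleFrames.HasIntegral μ
      (fun ω => HilbertModuleFrames.ip A f (G ω) * HilbertModuleFrames.ip A (G ω) f)
      (HilbertModuleFrames.ip A (HilbertModuleFrames.frameOperator A μ G f) f)) ∧
    -- `T_G T_F^*` is adjointable
    (∃ L' : U → U, HilbertModuleFrames.IsAdjoint A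
      (fun f => HilbertModuleFrames.synthesis μ G (HilbertModuleFrames.analysis A F f)) L') ∧
    -- and has a two-sided inverse `K`, which is adjointable with adjoint `K'`
    ∃ K K' : U → U, HilbertModuleFrames.IsAdjoint A K K' ∧
      (∀ f : U,
        K (HilbertModuleFrames.synthesis μ G (HilbertModuleFrames.analysis A F f)) = f) ∧
      (∀ f : U,
        HilbertModuleFrames.synthesis μ G (HilbertModuleFrames.analysis A F (K f)) = f) ∧
      -- `G = S_G K^* F` weakly almost everywhere
      (∀ f : U, ∀ᵐ ω ∂μ, HilbertModuleFrames.ip A f (G ω) =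
        HilbertModuleFrames.ip A f (HilbertModuleFrames.frameOperator A μ G (K' (F ω)))) ∧
      -- and almost everywhere if `F` and `G` are almost separably valued
      (∀ Z : Set U, TopologicalSpace.IsSeparable Z →
        (∀ᵐ ω ∂μ, F ω ∈ Z) → (∀ᵐ ω ∂μ, G ω ∈ Z) →
        ∀ᵐ ω ∂μ, G ω = HilbertModuleFrames.frameOperator A μ G (K' (F ω))) := by
  refine ⟨fun φ hφ => hF.hasVectorIntegral hφ, fun φ hφ => hG.hasVectorIntegral hφ,
    hF.analysis_mem, hG.analysis_mem, fun f => hG.hasVectorIntegral (hG.analysis_mem f) f,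
    ⟨_, hF.isAdjoint hG⟩, ?_⟩
  let L := Equiv.ofBijective _ ⟨hF.injective hG, hF.surjective hG⟩
  let L' := Equiv.ofBijective _ ⟨hG.injective hF, hG.surjective hF⟩
  have hadj : HilbertModuleFrames.IsAdjoint A L L' := hF.isAdjoint hG
  have hK : HilbertModuleFrames.IsAdjoint A L.symm L'.symm := fun f g => by
    have h := hadj (L.symm f) (L'.symm g)
    rw [L.apply_symm_apply, L'.apply_symm_apply] at h
    exact h.symm
  have hS : HilbertModuleFrames.IsAdjoint A (HilbertModuleFrames.frameOperator A μ G)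
      (HilbertModuleFrames.frameOperator A μ G) := hG.isAdjoint hG
  have hweak : ∀ f : U, ∀ᵐ ω ∂μ, HilbertModuleFrames.ip A f (G ω) =
      HilbertModuleFrames.ip A f
        (HilbertModuleFrames.frameOperator A μ G (L'.symm (F ω))) := by
    intro f
    -- Both `T_G^* f` and `T_F^* (K S_G f)` are sent by `T_G` to `S_G f`.
    have h := hG.ae_eq_analysis (hG.analysis_mem f) hF
      (L.symm (HilbertModuleFrames.frameOperator A μ G f)) (L.apply_symm_apply _).symm
    filter_upwards [h] with ω hω
    rw [← hS, ← hK]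
    exact hω
  refine ⟨L.symm, L'.symm, hK, L.symm_apply_apply, L.apply_symm_apply, hweak, ?_⟩
  intro Z hZ hFZ hGZ
  obtain ⟨S, hSe⟩ := hS.exists_clm
  obtain ⟨K', hKe⟩ := hK.symm.exists_clm
  -- A countable set dense among the differences `G ω - S_G K^* F ω` gives a single null set; by
  -- density each difference is then orthogonal to itself.
  have hsep : TopologicalSpace.IsSeparable ((fun p : U × U => p.1 - S (K' p.2)) '' (Z ×ˢ Z)) :=
    (hZ.prod hZ).image (by fun_prop)
  obtain ⟨c, hc, hcl⟩ := hsep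
  filter_upwards [hFZ, hGZ, (MeasureTheory.ae_ball_iff hc).2 fun f _ => hweak f]
    with ω hFω hGω hω
  simp only [← hSe, ← hKe] at hω ⊢
  have hmem : G ω - S (K' (F ω)) ∈ closure c := hcl ⟨(G ω, F ω), ⟨hGω, hFω⟩, rfl⟩
  have hclosed : IsClosed {u : U | HilbertModuleFrames.ip A u (G ω - S (K' (F ω))) = 0} :=
    isClosed_eq (HilbertModuleFrames.continuous_ip_left _) continuous_const
  have h0 := closure_minimal (fun f hf => ?_) hclosed hmem
  · exact sub_eq_zero.1 (CStarModule.inner_self.1 h0)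
  · have := hω f hf
    simp only [HilbertModuleFrames.ip, Set.mem_ofPred_eq] at this ⊢
    rw [CStarModule.inner_sub_left, this, sub_self]
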